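/- Let $\mathcal H$ be a complex separable Hilbert space and $n$ a finite non-negative integer. Inner products are linear in the first variable, $\mathbb C_\pm=\{z:\pm\operatorname{Im}z>0\}$, and $b(z)=\frac{z-i}{z+i}$. Let $T\in\mathcal S_n(\mathcal H)$, i.e. $T:\mathscr D(T)\subset\mathcal H\to\mathcal H$ is a closed, densely defined linear operator that is symmetric, simple ($\bigcap_{\operatorname{Im}\lambda\ne0}\operatorname{Rng}(T-\lambda I)=\{0\}$) and has deficiency indices $(n,n)$ ($\dim\operatorname{Rng}(T-iI)^\perp=\dim\operatorname{Rng}(T+iI)^\perp=n$). *Livsic function.* Let $T'$ be any self-adjoint extension of $T$ acting in $\mathcal H$ and let $\{u_j\}_{j=1}^n$ be any orthonormal basis of $\operatorname{Rng}(T+iI)^\perp=\operatorname{Ker}(T^*-iI)$. For $z\in\mathbb C_+$ let $A(z)$ and $B(z)$ be the $n\times n$ matrices whose entries in row $k$ and column $j$ are $$A(z)_{kj}=\big\langle (I+(z+i)(T'-zI)^{-1})u_j,u_k\big\rangle,\qquad B(z)_{kj}=\big\langle (I+(z-i)(T'-zI)^{-1})u_j,u_k\big\rangle,$$ and put $w_T(z)=b(z)B(z)^{-1}A(z)$.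 *Kernel function.* Let $\mathcal K$ be a Hilbert space of dimension $n$ and let $\Gamma:\mathbb C\setminus\mathbb R\to\mathcal B(\mathcal K,\mathcal H)$ be any model for $T$: (a) $\Gamma$ is co-analytic, i.e. $\lambda\mapsto\Gamma(\overline\lambda)$ is analytic; (b) for each $\lambda\in\mathbb C\setminus\mathbb R$, $\Gamma(\lambda)$ is an invertible map of $\mathcal K$ onto $\operatorname{Rng}(T-\lambda I)^\perp$; (c) $\Gamma(z)^*\Gamma(\lambda)$ is invertible on $\mathcal K$ whenever $\lambda,z\in\mathbb C_+$ or $\lambda,z\in\mathbb C_-$; (d) the closed linear span of $\bigcup_{\operatorname{Im}\lambda\ne0}\operatorname{Rng}\Gamma(\lambda)$ is $\mathcal H$. Put $K_\lambda(z)=\Gamma(z)^*\Gamma(\lambda)$, $$\Phi(z)=K_i(z)K_i(i)^{-1/2},\qquad \Psi(z)=K_{-i}(z)K_{-i}(-i)^{-1/2},\qquad V(z)=b(z)\Phi(z)^{-1}\Psi(z),\quad z\in\mathbb C_+ ,$$ and regard $V(z)$ as an $n\times n$ matrix by means of any fixed orthonormal basis of $\mathcal K$. Then, for every $z\in\mathbb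 C_+$, the operator $T'-zI$ has a bounded everywhere defined inverse and $B(z)$ and $\Phi(z)$ are invertible (so that $w_T$ and $V$ are well defined), and there are constant unitary $n\times n$ matrices $R,Q$ such that $$w_T(z)=R\,V(z)\,Q,\qquad z\in\mathbb C_+,$$ i.e. $w_T$ and $V$ are equivalent. -/

import Mathlib

open scoped ComplexConjugate InnerProductSpace

noncomputable section

namespace Livsic

variable {H : Type*} [NormedAddCommGroup H] [InnerProductSpace ℂ H]
variable {K : Type*} [NormedAddCommGroup K] [InnerProductSpace ℂ K]

/-- The range `Rng (T - w I)` of a partially defined linear operator `T`. -/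
def rng (T : H →ₗ.[ℂ] H) (w : ℂ) : Submodule ℂ H :=
  LinearMap.range (T.toFun - w • T.domain.subtype)

/-- The class `S_n(H)`: simple, closed, symmetric, densely defined operators in `H` with
deficiency indices `(n, n)`, where `n` is finite. -/
structure MemS (n : ℕ) (T : H →ₗ.[ℂ] H) : Prop where
  dense : Dense (T.domain : Set H)
  symmetric : ∀ x y : T.domain, ⟪T x, (y : H)⟫_ℂ = ⟪(x : H), T y⟫_ℂ
  closed : T.IsClosed
  simple : (⨅ w : {w : ℂ // w.im ≠ 0}, rng T w) = ⊥
  deficiency_pos : Module.rank ℂ (rng T Complex.I)ᗮ = n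
  deficiency_neg : Module.rank ℂ (rng T (-Complex.I))ᗮ = n

/-- `T'` is a canonical self-adjoint extension of `T`, that is, a self-adjoint extension acting in
the same Hilbert space. -/
structure IsSelfAdjointExtension [CompleteSpace H] (T T' : H →ₗ.[ℂ] H) : Prop where
  le : T ≤ T'
  selfAdjoint : IsSelfAdjoint T'

/-- The bounded operator `S` is the two-sided inverse of `T - z I`. -/
def IsResolventAt (T : H →ₗ.[ℂ] H) (z : ℂ) (S : H →L[ℂ] H) : Prop :=
  (∀ u : H, ∃ hu : S u ∈ T.domain, T ⟨S u, hu⟩ - z • S u = u) ∧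
    ∀ x : T.domain, S (T x - z • (x : H)) = x

open Classical in
/-- The resolvent `(T - z I)⁻¹`; it has the value `0` if `T - z I` has no bounded inverse. -/
def resolventAt (T : H →ₗ.[ℂ] H) (z : ℂ) : H →L[ℂ] H :=
  if h : ∃ S : H →L[ℂ] H, IsResolventAt T z S then h.choose else 0

/-- The function `b(z) = (z - i) / (z + i)`. -/
def b (z : ℂ) : ℂ := (z - Complex.I) / (z + Complex.I)

/-- The matrix of the compression of `I + (z - i) (T' - z I)⁻¹` to the span of the orthonormal
vectors `u j`; Mathlib's inner product is linear in the second variable. -/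
def matB {n : ℕ} (T' : H →ₗ.[ℂ] H) (u : Fin n → H) (z : ℂ) : Matrix (Fin n) (Fin n) ℂ :=
  Matrix.of fun k j => ⟪u k, u j + (z - Complex.I) • resolventAt T' z (u j)⟫_ℂ

/-- The matrix of the compression of `I + (z + i) (T' - z I)⁻¹` to the span of the orthonormal
vectors `u j`. -/
def matA {n : ℕ} (T' : H →ₗ.[ℂ] H) (u : Fin n → H) (z : ℂ) : Matrix (Fin n) (Fin n) ℂ :=
  Matrix.of fun k j => ⟪u k, u j + (z + Complex.I) • resolventAt T' z (u j)⟫_ℂ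

/-- The Livsic characteristic function `w_T(z) = b(z) B(z)⁻¹ A(z)` built from a self-adjoint
extension `T'` of `T` and an orthonormal basis `u` of `Rng (T + i I)ᗮ`. -/
def charFun {n : ℕ} (T' : H →ₗ.[ℂ] H) (u : Fin n → H) (z : ℂ) : Matrix (Fin n) (Fin n) ℂ :=
  b z • ((matB T' u z)⁻¹ * matA T' u z)

variable [CompleteSpace H] [CompleteSpace K]

/-- The kernel `K_w(z) = Γ(z)* Γ(w)`. -/
def kernel (Γ : ℂ → K →L[ℂ] H) (w z : ℂ) : K →L[ℂ] K :=
  ContinuousLinearMap.adjoint (Γ z) ∘L Γ w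

/-- `Γ` is a model for `T`; only the values of `Γ` off the real axis matter. -/
structure IsModel (T : H →ₗ.[ℂ] H) (Γ : ℂ → K →L[ℂ] H) : Prop where
  coanalytic : AnalyticOnNhd ℂ (fun w => Γ (conj w)) {w : ℂ | w.im ≠ 0}
  injective : ∀ w : ℂ, w.im ≠ 0 → Function.Injective (Γ w)
  range_eq : ∀ w : ℂ, w.im ≠ 0 → LinearMap.range (Γ w).toLinearMap = (rng T w)ᗮ
  isUnit_kernel : ∀ w z : ℂ, (0 < w.im ∧ 0 < z.im) ∨ (w.im < 0 ∧ z.im < 0) →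
    IsUnit (kernel Γ w z)
  span_eq_top :
    (⨆ w : {w : ℂ // w.im ≠ 0}, LinearMap.range (Γ w).toLinearMap).topologicalClosure = ⊤

/-- `Φ(z) = K_i(z) K_i(i)^{-1/2}`. -/
def Phi (Γ : ℂ → K →L[ℂ] H) (z : ℂ) : K →L[ℂ] K :=
  kernel Γ Complex.I z * (kernel Γ Complex.I Complex.I) ^ (-(1 / 2) : ℝ)

/-- `Ψ(z) = K_{-i}(z) K_{-i}(-i)^{-1/2}`. -/
def Psi (Γ : ℂ → K →L[ℂ] H) (z : ℂ) : K →L[ℂ] K :=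
  kernel Γ (-Complex.I) z * (kernel Γ (-Complex.I) (-Complex.I)) ^ (-(1 / 2) : ℝ)

/-- `V(z) = b(z) Φ(z)⁻¹ Ψ(z)`. -/
def V (Γ : ℂ → K →L[ℂ] H) (z : ℂ) : K →L[ℂ] K :=
  b z • (Ring.inverse (Phi Γ z) * Psi Γ z)

/-- Two matrix functions on the upper half plane are equivalent if they agree up to multiplication
by constant unitary matrices on the left and on the right. -/
def Equivalent {n : ℕ} (w₁ w₂ : ℂ → Matrix (Fin n) (Fin n) ℂ) : Prop :=
  ∃ R ∈ Matrix.unitaryGroup (Fin n) ℂ, ∃ Q ∈ Matrix.unitaryGroup (Fin n) ℂ,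
    ∀ z : ℂ, 0 < z.im → w₁ z = R * w₂ z * Q

end Livsic

end

/-! For a self-adjoint extension `T'`, put U(a,z) = (T' - a)(T' - z)⁻¹ = I + (z - a)(T' - z)⁻¹,
which is `transfer`. These operators compose, U(c,z) U(a,c) = U(a,z) (`transfer_transfer`), have
adjoints U(a,z)* = U(a̅,z̅), and carry one defect space of `T` into another
(`transfer_mem_orthogonal`).

Hence the vectors U(i,z̅) u_k lie in the range of Γ(z) and equal Γ(z) c_k. Passing to adjoints,
A(z)_{kj} = ⟨c_k, Γ(z)* u_j⟩. Since U(i,z) = U(-i,z) U(i,-i), also B(z)_{kj} = ⟨c_k, Γ(z)* v_j⟩,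
where v_j = U(i,-i) u_j is the Cayley transform of u_j.

Because Γ(w) K_w(w)^{-1/2} is isometric, the u_j (w = -i) and the v_j (w = i) come from orthonormal
bases f and g of `K`, independent of z (`exists_orthonormalBasis_model`). So A = N Ψ F and B = N Φ G
with the same invertible N(z) and constant unitary F, G. In B⁻¹A the factor N cancels, leaving G*
Φ⁻¹ Ψ F. -/

namespace Livsic

section Definitions

variable {H : Type*} [NormedAddCommGroup H] [InnerProductSpace ℂ H]

/-- The map `(x, y) ↦ y - z x` on the graph of `A`. -/
noncomputable def graphSub (A : H →ₗ.[ℂ] H) (z : ℂ) : A.graph →L[ℂ] H :=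
  (ContinuousLinearMap.snd ℂ H H - z • ContinuousLinearMap.fst ℂ H H) ∘L A.graph.subtypeL

theorem graphSub_apply (A : H →ₗ.[ℂ] H) (z : ℂ) (p : A.graph) :
    graphSub A z p = (p : H × H).2 - z • (p : H × H).1 := rfl

/-- The operator `I + (z - a) (A - z)⁻¹`, that is `(A - a) (A - z)⁻¹`. -/
noncomputable def transfer (A : H →ₗ.[ℂ] H) (a z : ℂ) : H →L[ℂ] H :=
  ContinuousLinearMap.id ℂ H + (z - a) • resolventAt A z

theorem transfer_apply (a z : ℂ) (v : H) :
    transfer A a z v = v + (z - a) • resolventAt A z v := rfl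

end Definitions

/-! ### Resolvents and transfer operators of a self-adjoint operator. -/

section SelfAdjoint

variable {H : Type*} [NormedAddCommGroup H] [InnerProductSpace ℂ H] [CompleteSpace H]
variable {A : H →ₗ.[ℂ] H}

/-- A self-adjoint operator is symmetric. -/
theorem symmetric_of_isSelfAdjoint (hA : IsSelfAdjoint A) (x y : A.domain) :
    ⟪A x, (y : H)⟫_ℂ = ⟪(x : H), A y⟫_ℂ := by
  have h := A.adjoint_isFormalAdjoint hA.dense_domain
  rw [LinearPMap.isSelfAdjoint_def.mp hA] at h
  exact h x y

/-- The basic lower bound `|Im z| ‖x‖ ≤ ‖(A - z) x‖` for a self-adjoint operator `A`. -/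
theorem abs_im_mul_norm_le (hA : IsSelfAdjoint A) (z : ℂ) (x : A.domain) :
    |z.im| * ‖(x : H)‖ ≤ ‖A x - z • (x : H)‖ := by
  have hreal : (⟪(x : H), A x⟫_ℂ).im = 0 := by
    rw [← Complex.conj_eq_iff_im, inner_conj_symm]
    exact symmetric_of_isSelfAdjoint hA x x
  have him : (⟪(x : H), A x - z • (x : H)⟫_ℂ).im = -(z.im * (‖(x : H)‖ * ‖(x : H)‖)) := by
    rw [inner_sub_right, inner_smul_right, inner_self_eq_norm_sq_to_K, Complex.sub_im, hreal]
    change 0 - (z * (((‖(x : H)‖ : ℝ) : ℂ) ^ 2)).im = _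
    rw [← Complex.ofReal_pow, Complex.im_mul_ofReal, sq, zero_sub]
  have h := (Complex.abs_im_le_norm _).trans (norm_inner_le_norm (𝕜 := ℂ) (x : H) (A x - z • (x : H)))
  rw [him, abs_neg, abs_mul, abs_of_nonneg (mul_self_nonneg ‖(x : H)‖)] at h
  rcases (norm_nonneg (x : H)).eq_or_lt with h0 | h0
  · rw [← h0, mul_zero]
    exact norm_nonneg _
  · refine le_of_mul_le_mul_left ?_ h0
    linarith

/-- The lower bound `abs_im_mul_norm_le` controls the first coordinate of a graph point (x, y), and
y = (y - z x) + z x then controls the second. -/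
theorem antilipschitz_graphSub (hA : IsSelfAdjoint A) {z : ℂ} (hz : z.im ≠ 0) :
    ∃ c, AntilipschitzWith c (graphSub A z) := by
  have hz' : 0 < |z.im| := abs_pos.mpr hz
  refine ⟨⟨1 + (1 + ‖z‖) / |z.im|, by positivity⟩,
    ContinuousLinearMap.antilipschitz_of_bound _ fun p => ?_⟩
  obtain ⟨x, hx1, hx2⟩ := A.mem_graph_iff.mp p.2
  have hb := abs_im_mul_norm_le hA z x
  rw [hx1, hx2, ← graphSub_apply] at hb
  have h2 : ‖(p : H × H).2‖ ≤ ‖graphSub A z p‖ + ‖z‖ * ‖(p : H × H).1‖ := by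
    rw [← norm_smul]
    calc ‖(p : H × H).2‖ = ‖graphSub A z p + z • (p : H × H).1‖ := by
          rw [graphSub_apply, sub_add_cancel]
      _ ≤ _ := norm_add_le _ _
  have h1 : ‖(p : H × H).1‖ ≤ ‖graphSub A z p‖ / |z.im| := by
    rw [le_div_iff₀ hz']
    linarith
  have h3 : ‖p‖ ≤ ‖(p : H × H).1‖ + ‖(p : H × H).2‖ :=
    max_le (le_add_of_nonneg_right (norm_nonneg _)) (le_add_of_nonneg_left (norm_nonneg _))
  have h4 : ‖z‖ * ‖(p : H × H).1‖ ≤ ‖z‖ * (‖graphSub A z p‖ / |z.im|) :=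
    mul_le_mul_of_nonneg_left h1 (norm_nonneg _)
  change ‖p‖ ≤ (1 + (1 + ‖z‖) / |z.im|) * ‖graphSub A z p‖
  calc ‖p‖ ≤ ‖graphSub A z p‖ / |z.im| +
        (‖graphSub A z p‖ + ‖z‖ * (‖graphSub A z p‖ / |z.im|)) := by linarith
    _ = _ := by ring

/-- A vector orthogonal to the range is an eigenvector of A* = A for z̅ or zero; the lower bound at
z̅ rules out the former. -/
theorem range_graphSub_orthogonal (hA : IsSelfAdjoint A) {z : ℂ} (hz : z.im ≠ 0) :
    (LinearMap.range (graphSub A z).toLinearMap)ᗮ = ⊥ := by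
  rw [Submodule.eq_bot_iff]
  intro y hy
  have hxy : ∀ x : A.domain, ⟪conj z • y, (x : H)⟫_ℂ = ⟪y, A x⟫_ℂ := fun x => by
    have h := Submodule.inner_left_of_mem_orthogonal
      (LinearMap.mem_range_self (graphSub A z).toLinearMap ⟨((x : H), A x), A.mem_graph x⟩) hy
    have h' : ⟪y, A x - z • (x : H)⟫_ℂ = 0 := h
    rw [inner_sub_right, inner_smul_right, sub_eq_zero] at h'
    rw [h', inner_smul_left, Complex.conj_conj]
  have hy1 := A.mem_adjoint_domain_of_exists y ⟨_, hxy⟩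
  have hy2 := LinearPMap.adjoint_apply_eq hA.dense_domain ⟨y, hy1⟩ hxy
  obtain ⟨y', hy3, hy4⟩ : ∃ y' : A.domain, (y' : H) = y ∧ A y' = conj z • y := by
    refine A.mem_graph_iff (x := (y, conj z • y)).mp ?_
    rw [← LinearPMap.isSelfAdjoint_def.mp hA, LinearPMap.mem_graph_iff]
    exact ⟨⟨y, hy1⟩, rfl, hy2⟩
  have h := abs_im_mul_norm_le hA (conj z) y'
  rw [hy4, hy3, sub_self, norm_zero, Complex.conj_im, abs_neg] at h
  have h0 : 0 < |z.im| := abs_pos.mpr hz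
  exact norm_eq_zero.mp (le_antisymm (nonpos_of_mul_nonpos_right h h0) (norm_nonneg _))

/-- The resolvent of a self-adjoint operator exists off the real axis. -/
theorem exists_isResolventAt (hA : IsSelfAdjoint A) {z : ℂ} (hz : z.im ≠ 0) :
    ∃ S : H →L[ℂ] H, IsResolventAt A z S := by
  -- The closed graph is a Banach space, so a bounded map on it that is bounded below and has dense
  -- range is an isomorphism; the resolvent is the first coordinate of its inverse.
  have hcl : IsClosed (A.graph : Set (H × H)) := hA.isClosed
  have : CompleteSpace A.graph := hcl.completeSpace_coe
  obtain ⟨c, hc⟩ := antilipschitz_graphSub hA hz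
  have hker : LinearMap.ker (graphSub A z).toLinearMap = ⊥ := LinearMap.ker_eq_bot.mpr hc.injective
  have hran : LinearMap.range (graphSub A z).toLinearMap = ⊤ := by
    have hcl' : IsClosed (LinearMap.range (graphSub A z).toLinearMap : Set H) :=
      hc.isClosed_range (graphSub A z).uniformContinuous
    rw [← hcl'.submodule_topologicalClosure_eq, Submodule.topologicalClosure_eq_top_iff]
    exact range_graphSub_orthogonal hA hz
  let E := ContinuousLinearEquiv.ofBijective (graphSub A z) hker hran
  have hE : ∀ p, E p = graphSub A z p := fun _ => rfl
  refine ⟨ContinuousLinearMap.fst ℂ H H ∘L A.graph.subtypeL ∘L (E.symm : H →L[ℂ] A.graph),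
    fun v => ?_, fun x => ?_⟩
  · obtain ⟨x, hx1, hx2⟩ := A.mem_graph_iff.mp (E.symm v).2
    have hv : ((E.symm v : A.graph) : H × H).2 - z • ((E.symm v : A.graph) : H × H).1 = v := by
      rw [← graphSub_apply, ← hE, E.apply_symm_apply]
    have hmem : ((E.symm v : A.graph) : H × H).1 ∈ A.domain := hx1 ▸ x.2
    refine ⟨hmem, ?_⟩
    refine Eq.trans ?_ hv
    rw [← hx2]
    congr 2
    exact Subtype.ext hx1.symm
  · have hx : A x - z • (x : H) = E ⟨((x : H), A x), A.mem_graph x⟩ := rfl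
    rw [hx]
    change ((E.symm (E _) : A.graph) : H × H).1 = x
    rw [E.symm_apply_apply]

theorem isResolventAt_resolventAt (hA : IsSelfAdjoint A) {z : ℂ} (hz : z.im ≠ 0) :
    IsResolventAt A z (resolventAt A z) := by
  have h := exists_isResolventAt hA hz
  rw [resolventAt, dif_pos h]
  exact h.choose_spec

theorem exists_sub_smul_eq (hA : IsSelfAdjoint A) {z : ℂ} (hz : z.im ≠ 0) (v : H) :
    ∃ x : A.domain, v = A x - z • (x : H) ∧ resolventAt A z v = x := by
  obtain ⟨hu, h⟩ := (isResolventAt_resolventAt hA hz).1 v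
  exact ⟨⟨_, hu⟩, h.symm, rfl⟩

theorem inner_resolventAt_left (hA : IsSelfAdjoint A) {z : ℂ} (hz : z.im ≠ 0) (v w : H) :
    ⟪resolventAt A (conj z) v, w⟫_ℂ = ⟪v, resolventAt A z w⟫_ℂ := by
  have hz' : (conj z).im ≠ 0 := by simpa using hz
  obtain ⟨x, hx, hx'⟩ := exists_sub_smul_eq hA hz' v
  obtain ⟨y, hy, hy'⟩ := exists_sub_smul_eq hA hz w
  rw [hx', hy', hx, hy, inner_sub_left, inner_sub_right, inner_smul_left, inner_smul_right,
    Complex.conj_conj, symmetric_of_isSelfAdjoint hA]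

theorem transfer_sub_smul (hA : IsSelfAdjoint A) (a : ℂ) {z : ℂ} (hz : z.im ≠ 0) (x : A.domain) :
    transfer A a z (A x - z • (x : H)) = A x - a • (x : H) := by
  rw [transfer_apply, (isResolventAt_resolventAt hA hz).2 x]
  module

theorem transfer_transfer (hA : IsSelfAdjoint A) (a : ℂ) {c z : ℂ} (hc : c.im ≠ 0) (hz : z.im ≠ 0)
    (v : H) : transfer A c z (transfer A a c v) = transfer A a z v := by
  obtain ⟨x, rfl, -⟩ := exists_sub_smul_eq hA hc v
  rw [transfer_sub_smul hA a hc]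
  have h := fun t => (isResolventAt_resolventAt hA hz).2 t
  have hx : resolventAt A z (A x) = (x : H) + z • resolventAt A z x := by
    have h' := (isResolventAt_resolventAt hA hz).2 x
    rw [map_sub, map_smul] at h'
    rw [← h', h']
    exact (sub_eq_iff_eq_add.mp h')
  simp only [transfer_apply, map_sub, map_smul, hx]
  module

theorem transfer_injective (hA : IsSelfAdjoint A) {a z : ℂ} (ha : a.im ≠ 0) (hz : z.im ≠ 0) :
    Function.Injective (transfer A a z) := by
  rw [injective_iff_map_eq_zero]
  intro v hv
  have h := transfer_transfer hA a hz ha v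
  rw [hv, map_zero, transfer_apply, sub_self, zero_smul, add_zero] at h
  exact h.symm

theorem inner_transfer_left (hA : IsSelfAdjoint A) (a : ℂ) {z : ℂ} (hz : z.im ≠ 0) (v w : H) :
    ⟪transfer A (conj a) (conj z) v, w⟫_ℂ = ⟪v, transfer A a z w⟫_ℂ := by
  rw [transfer_apply, transfer_apply, inner_add_left, inner_add_right, inner_smul_left,
    inner_smul_right, inner_resolventAt_left hA hz, map_sub, Complex.conj_conj, Complex.conj_conj]

theorem transfer_mem_orthogonal {T : H →ₗ.[ℂ] H} (hT : T ≤ A) (hA : IsSelfAdjoint A) {a z : ℂ}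
    (hz : z.im ≠ 0) {v : H} (hv : v ∈ (rng T (conj a))ᗮ) :
    transfer A a z v ∈ (rng T (conj z))ᗮ := by
  have hz' : (conj z).im ≠ 0 := by simpa using hz
  rintro _ ⟨x, rfl⟩
  have hx : T x = A ⟨x, hT.1 x.2⟩ := hT.2 rfl
  have hw : ∀ w : ℂ, (T.toFun - w • T.domain.subtype) x =
      A ⟨x, hT.1 x.2⟩ - w • ((⟨x, hT.1 x.2⟩ : A.domain) : H) := fun w => by
    rw [← hx]; rfl
  rw [hw, ← inner_transfer_left hA a hz, transfer_sub_smul hA _ hz', ← hw]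
  exact hv _ (LinearMap.mem_range_self _ x)

/-- The Cayley transform preserves inner products. -/
theorem inner_transfer_transfer (hA : IsSelfAdjoint A) {z : ℂ} (hz : z.im ≠ 0) (v w : H) :
    ⟪transfer A (conj z) z v, transfer A (conj z) z w⟫_ℂ = ⟪v, w⟫_ℂ := by
  have hz' : (conj z).im ≠ 0 := by simpa using hz
  -- The adjoint U(z,z̅) of U(z̅,z) is also its inverse.
  rw [← inner_transfer_left hA (conj z) hz, Complex.conj_conj, transfer_transfer hA _ hz hz']
  simp [transfer_apply]

end SelfAdjoint

/-! ### Matrices of vectors and operators in orthonormal bases. -/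

section Matrix

variable {K : Type*} [NormedAddCommGroup K] [InnerProductSpace ℂ K]
variable {ι : Type*} [Fintype ι]

theorem isUnit_toMatrix_of_linearIndependent [DecidableEq ι] {R M : Type*} [Field R]
    [AddCommGroup M] [Module R M]
    (e : Module.Basis ι R M) {c : ι → M} (hc : LinearIndependent R c) : IsUnit (e.toMatrix c) := by
  have : FiniteDimensional R M := e.finiteDimensional_of_finite
  let c' := Module.Basis.mk hc
    (hc.span_eq_top_of_card_eq_finrank' (Module.finrank_eq_card_basis e).symm).ge
  have h : ⇑c' = c := Module.Basis.coe_mk _ _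
  rw [← h]
  exact IsUnit.of_mul_eq_one _ (e.toMatrix_mul_toMatrix_flip c')

theorem exists_orthonormalBasis_coe_eq {E : Type*} [NormedAddCommGroup E] [InnerProductSpace ℂ E]
    (e : OrthonormalBasis ι ℂ E) {v : ι → E} (hv : Orthonormal ℂ v) :
    ∃ f : OrthonormalBasis ι ℂ E, ⇑f = v := by
  have : FiniteDimensional ℂ E := e.toBasis.finiteDimensional_of_finite
  exact ⟨OrthonormalBasis.mk hv (hv.linearIndependent.span_eq_top_of_card_eq_finrank'
    (Module.finrank_eq_card_basis e.toBasis).symm).ge, OrthonormalBasis.coe_mk _ _⟩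

/-- The matrix `⟪c k, L (f j)⟫` in terms of the matrix of `L` with respect to `e`. -/
theorem of_inner_eq_mul [DecidableEq ι] (e : OrthonormalBasis ι ℂ K) (c f : ι → K)
    (L : K →L[ℂ] K) :
    Matrix.of (fun k j => ⟪c k, L (f j)⟫_ℂ) =
      (e.toBasis.toMatrix c).conjTranspose * LinearMap.toMatrix e.toBasis e.toBasis L.toLinearMap *
        e.toBasis.toMatrix f := by
  have h : LinearMap.toMatrix e.toBasis e.toBasis L.toLinearMap * e.toBasis.toMatrix f =
      e.toBasis.toMatrix (fun j => L (f j)) := by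
    ext l j
    exact congrFun (LinearMap.toMatrix_mulVec_repr e.toBasis e.toBasis L.toLinearMap (f j)) l
  rw [Matrix.mul_assoc, h]
  ext k j
  rw [Matrix.of_apply, ← e.sum_inner_mul_inner, Matrix.mul_apply]
  refine Finset.sum_congr rfl fun l _ => ?_
  rw [Matrix.conjTranspose_apply, Module.Basis.toMatrix_apply, Module.Basis.toMatrix_apply,
    e.coe_toBasis_repr_apply, e.coe_toBasis_repr_apply, e.repr_apply_apply, e.repr_apply_apply,
    ← inner_conj_symm, starRingEnd_apply]

end Matrix

/-! ### Normalising the model Γ at a single point. -/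

section Model

variable {H : Type*} [NormedAddCommGroup H] [InnerProductSpace ℂ H] [CompleteSpace H]
variable {K : Type*} [NormedAddCommGroup K] [InnerProductSpace ℂ K] [CompleteSpace K]
variable {ι : Type*} [Fintype ι] [DecidableEq ι]
variable {T : H →ₗ.[ℂ] H} {Γ : ℂ → K →L[ℂ] H}

theorem isStrictlyPositive_kernel (hΓ : IsModel T Γ) {w : ℂ} (hw : w.im ≠ 0) :
    IsStrictlyPositive (kernel Γ w w) := by
  rw [IsStrictlyPositive.iff_of_unital]
  refine ⟨?_, hΓ.isUnit_kernel w w ?_⟩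
  · rw [ContinuousLinearMap.nonneg_iff_isPositive]
    exact ContinuousLinearMap.isPositive_adjoint_comp_self _
  · rcases lt_or_gt_of_ne hw with h | h
    · exact Or.inr ⟨h, h⟩
    · exact Or.inl ⟨h, h⟩

theorem isUnit_kernel_rpow (hΓ : IsModel T Γ) {w : ℂ} (hw : w.im ≠ 0) (s : ℝ) :
    IsUnit (kernel Γ w w ^ s) :=
  ((isStrictlyPositive_kernel hΓ hw).rpow _ s).isUnit

/-- `Γ(w) K_w(w)^{-1/2}` is an isometry. -/
theorem inner_model_rpow (hΓ : IsModel T Γ) {w : ℂ} (hw : w.im ≠ 0) (x y : K) :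
    ⟪Γ w ((kernel Γ w w ^ (-(1 / 2) : ℝ)) x), Γ w ((kernel Γ w w ^ (-(1 / 2) : ℝ)) y)⟫_ℂ =
      ⟪x, y⟫_ℂ := by
  -- K^{-1/2} K K^{-1/2} = 1, with K = Γ(w)*Γ(w) and K^{-1/2} self-adjoint.
  have h := CFC.conjugate_rpow_neg_one_half _ (isStrictlyPositive_kernel hΓ hw)
  have hs : IsSelfAdjoint (kernel Γ w w ^ (-(1 / 2) : ℝ)) :=
    IsSelfAdjoint.of_nonneg CFC.rpow_nonneg
  have hy := congrArg (fun L : K →L[ℂ] K => ⟪x, L y⟫_ℂ) h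
  simp only [mul_apply_eq_comp, one_apply_eq_self] at hy
  rw [← hy, ← ContinuousLinearMap.adjoint_inner_right]
  exact ContinuousLinearMap.isSelfAdjoint_iff_isSymmetric.mp hs x _

/-- An orthonormal family in `Rng (T - w I)ᗮ` is the image under `Γ(w) K_w(w)^{-1/2}` of an
orthonormal basis of `K`. -/
theorem exists_orthonormalBasis_model (hΓ : IsModel T Γ) (e : OrthonormalBasis ι ℂ K) {w : ℂ}
    (hw : w.im ≠ 0) {v : ι → H} (hv : Orthonormal ℂ v) (hmem : ∀ j, v j ∈ (rng T w)ᗮ) :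
    ∃ f : OrthonormalBasis ι ℂ K, ∀ j, Γ w ((kernel Γ w w ^ (-(1 / 2) : ℝ)) (f j)) = v j := by
  obtain ⟨S, hS⟩ := isUnit_kernel_rpow hΓ hw (-(1 / 2))
  have hex : ∀ j, ∃ x, Γ w ((kernel Γ w w ^ (-(1 / 2) : ℝ)) x) = v j := fun j => by
    have h := hmem j
    rw [← hΓ.range_eq w hw] at h
    obtain ⟨p, hp⟩ := h
    refine ⟨(↑S⁻¹ : K →L[ℂ] K) p, ?_⟩
    rw [← hS, ← mul_apply_eq_comp, S.mul_inv]
    exact hp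
  choose f hf using hex
  have hfo : Orthonormal ℂ f := by
    rw [orthonormal_iff_ite] at hv ⊢
    intro j k
    rw [← hv j k, ← hf j, ← hf k, inner_model_rpow hΓ hw]
  obtain ⟨f', rfl⟩ := exists_orthonormalBasis_coe_eq e hfo
  exact ⟨f', hf⟩

theorem isUnit_Phi (hΓ : IsModel T Γ) {z : ℂ} (hz : 0 < z.im) : IsUnit (Phi Γ z) :=
  (hΓ.isUnit_kernel _ _ (Or.inl ⟨by simp, hz⟩)).mul (isUnit_kernel_rpow hΓ (by simp) _)

end Model

end Livsic

/-! ### Factorisation of A and B, and the equivalence. -/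

theorem mainTheorem3 {H : Type*} [NormedAddCommGroup H] [InnerProductSpace ℂ H] [CompleteSpace H]
    [TopologicalSpace.SeparableSpace H]
    {K : Type*} [NormedAddCommGroup K] [InnerProductSpace ℂ K] [CompleteSpace K]
    (n : ℕ) (T : H →ₗ.[ℂ] H) (hT : Livsic.MemS n T)
    (T' : H →ₗ.[ℂ] H) (hT' : Livsic.IsSelfAdjointExtension T T')
    (u : OrthonormalBasis (Fin n) ℂ (Livsic.rng T (-Complex.I))ᗮ)
    (Γ : ℂ → K →L[ℂ] H) (hΓ : Livsic.IsModel T Γ)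
    (e : OrthonormalBasis (Fin n) ℂ K) :
    (∀ z : ℂ, 0 < z.im →
      Livsic.IsResolventAt T' z (Livsic.resolventAt T' z) ∧
      IsUnit (Livsic.matB T' (fun j => (u j : H)) z) ∧
      IsUnit (Livsic.Phi Γ z)) ∧
    Livsic.Equivalent (Livsic.charFun T' (fun j => (u j : H)))
      (fun z => LinearMap.toMatrix e.toBasis e.toBasis (Livsic.V Γ z).toLinearMap) := by
  open Livsic in
  have hA := hT'.selfAdjoint
  have hI : (Complex.I).im ≠ 0 := by simp
  have hI' : (-Complex.I).im ≠ 0 := by simp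
  have hIc : conj (-Complex.I) = Complex.I := by simp
  have hu : Orthonormal ℂ (fun j => (u j : H)) :=
    u.orthonormal.comp_linearIsometry (Livsic.rng T (-Complex.I))ᗮ.subtypeₗᵢ
  have humem : ∀ j, (u j : H) ∈ (rng T (-Complex.I))ᗮ := fun j => (u j).2
  have humem' : ∀ j, (u j : H) ∈ (rng T (conj Complex.I))ᗮ := fun j => by
    rw [Complex.conj_I]; exact humem j
  obtain ⟨f, hf⟩ := exists_orthonormalBasis_model hΓ e hI' hu humem
  have hv : Orthonormal ℂ (fun j => transfer T' Complex.I (-Complex.I) (u j : H)) := by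
    rw [orthonormal_iff_ite] at hu ⊢
    intro j k
    have h := inner_transfer_transfer hA hI' (u j : H) (u k : H)
    rw [hIc] at h
    rw [h, hu]
  obtain ⟨g, hg⟩ := exists_orthonormalBasis_model hΓ e hI hv fun j => by
    have h := transfer_mem_orthogonal hT'.le hA hI' (humem' j)
    rwa [hIc] at h
  -- N may depend on z, but must be shared by A and B so that it cancels.
  have key : ∀ z : ℂ, 0 < z.im → ∃ N : Matrix (Fin n) (Fin n) ℂ, IsUnit N ∧
      matA T' (fun j => (u j : H)) z =
        N * LinearMap.toMatrix e.toBasis e.toBasis (Psi Γ z).toLinearMap * e.toBasis.toMatrix f ∧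
      matB T' (fun j => (u j : H)) z =
        N * LinearMap.toMatrix e.toBasis e.toBasis (Phi Γ z).toLinearMap * e.toBasis.toMatrix g := by
    intro z hz
    have hz0 : z.im ≠ 0 := hz.ne'
    have hz1 : (conj z).im ≠ 0 := by simpa using hz0
    have hex : ∀ k, ∃ c, Γ z c = transfer T' Complex.I (conj z) (u k : H) := fun k => by
      have h := transfer_mem_orthogonal hT'.le hA hz1 (humem' k)
      rw [Complex.conj_conj, ← hΓ.range_eq z hz0] at h
      exact h
    choose c hc using hex
    have hci : LinearIndependent ℂ c := by
      refine LinearIndependent.of_comp (Γ z).toLinearMap ?_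
      have h : (Γ z).toLinearMap ∘ c =
          (transfer T' Complex.I (conj z)).toLinearMap ∘ fun k => (u k : H) := funext hc
      rw [h]
      exact hu.linearIndependent.map' _ (LinearMap.ker_eq_bot.mpr (transfer_injective hA hI hz1))
    have hcw : ∀ (k : Fin n) (x : H), ⟪c k, ContinuousLinearMap.adjoint (Γ z) x⟫_ℂ =
        ⟪(u k : H), transfer T' (-Complex.I) z x⟫_ℂ := fun k x => by
      rw [ContinuousLinearMap.adjoint_inner_right, hc, ← inner_transfer_left hA _ hz0, hIc]
    refine ⟨_, (isUnit_toMatrix_of_linearIndependent e.toBasis hci).star, ?_, ?_⟩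
    · refine Eq.trans ?_ (of_inner_eq_mul e c f (Psi Γ z))
      ext k j
      refine Eq.trans ?_ (hcw k _).symm
      refine Eq.trans ?_
        (congrArg (fun x => ⟪(u k : H), transfer T' (-Complex.I) z x⟫_ℂ) (hf j).symm)
      rw [transfer_apply, sub_neg_eq_add]
      rfl
    · refine Eq.trans ?_ (of_inner_eq_mul e c g (Phi Γ z))
      ext k j
      refine Eq.trans ?_ (hcw k _).symm
      refine Eq.trans ?_
        (congrArg (fun x => ⟪(u k : H), transfer T' (-Complex.I) z x⟫_ℂ) (hg j).symm)
      -- U(-i,z) U(i,-i) = U(i,z) turns the Cayley transforms back into the entries of B.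
      rw [transfer_transfer hA _ hI' hz0]
      rfl
  have hP : ∀ z : ℂ, 0 < z.im →
      IsUnit (LinearMap.toMatrix e.toBasis e.toBasis (Phi Γ z).toLinearMap) := fun z hz => by
    rw [LinearMap.isUnit_toMatrix_iff]
    exact (isUnit_Phi hΓ hz).map ContinuousLinearMap.toLinearMapRingHom
  have hG := e.toMatrix_orthonormalBasis_mem_unitary g
  have hGu : IsUnit (e.toBasis.toMatrix g) :=
    IsUnit.of_mul_eq_one _ (Matrix.mem_unitaryGroup_iff.mp hG)
  refine ⟨fun z hz => ⟨isResolventAt_resolventAt hA hz.ne', ?_, isUnit_Phi hΓ hz⟩,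
    star (e.toBasis.toMatrix g), Unitary.star_mem hG, e.toBasis.toMatrix f,
    e.toMatrix_orthonormalBasis_mem_unitary f, fun z hz => ?_⟩
  · obtain ⟨N, hN, -, hB⟩ := key z hz
    rw [hB]
    exact (hN.mul (hP z hz)).mul hGu
  · obtain ⟨N, hN, hAz, hBz⟩ := key z hz
    have hGi : (e.toBasis.toMatrix g)⁻¹ = star (e.toBasis.toMatrix g) :=
      Matrix.inv_eq_left_inv (Matrix.mem_unitaryGroup_iff'.mp hG)
    have hPi : (LinearMap.toMatrix e.toBasis e.toBasis (Phi Γ z).toLinearMap)⁻¹ =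
        LinearMap.toMatrix e.toBasis e.toBasis (Ring.inverse (Phi Γ z)).toLinearMap := by
      refine Matrix.inv_eq_left_inv ?_
      rw [← LinearMap.toMatrix_mul]
      have h := congrArg ContinuousLinearMap.toLinearMap
        (Ring.inverse_mul_cancel _ (isUnit_Phi hΓ hz))
      exact (congrArg (LinearMap.toMatrix e.toBasis e.toBasis) h).trans
        (LinearMap.toMatrix_one e.toBasis)
    have hNi : N⁻¹ * N = 1 := Matrix.nonsing_inv_mul _ ((Matrix.isUnit_iff_isUnit_det _).mp hN)
    have hVz : LinearMap.toMatrix e.toBasis e.toBasis (V Γ z).toLinearMap = b z •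
        (LinearMap.toMatrix e.toBasis e.toBasis (Ring.inverse (Phi Γ z)).toLinearMap *
          LinearMap.toMatrix e.toBasis e.toBasis (Psi Γ z).toLinearMap) := by
      rw [← LinearMap.toMatrix_mul, ← map_smul]
      rfl
    change b z • ((matB T' (fun j => (u j : H)) z)⁻¹ * matA T' (fun j => (u j : H)) z) =
      star (e.toBasis.toMatrix g) *
        LinearMap.toMatrix e.toBasis e.toBasis (V Γ z).toLinearMap * e.toBasis.toMatrix f
    have h : (matB T' (fun j => (u j : H)) z)⁻¹ * matA T' (fun j => (u j : H)) z =
        star (e.toBasis.toMatrix g) *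
          (LinearMap.toMatrix e.toBasis e.toBasis (Ring.inverse (Phi Γ z)).toLinearMap *
            LinearMap.toMatrix e.toBasis e.toBasis (Psi Γ z).toLinearMap) *
          e.toBasis.toMatrix f := by
      rw [hAz, hBz, Matrix.mul_inv_rev, Matrix.mul_inv_rev, hGi, hPi]
      simp only [Matrix.mul_assoc]
      rw [← Matrix.mul_assoc N⁻¹ N, hNi, Matrix.one_mul]
    rw [hVz, h, Matrix.mul_smul, Matrix.smul_mul]
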